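/- Let $n\ge 2$, let $\mathcal G$ be a finite-dimensional simple Lie algebra over $\mathbb C$ with a non-degenerate invariant symmetric bilinear form $(\cdot,\cdot)$ and a Cartan subalgebra $h$. Let $\mathcal G_{\rm aff}=\mathcal G\otimes\mathbb C[t_n^{\pm1}]\oplus\mathbb C K_n$, with $K_n$ central and $$[X\otimes t_n^r,\,Y\otimes t_n^s]=[X,Y]\otimes t_n^{r+s}+r\,\delta_{r+s,0}\,(X,Y)\,K_n .$$ Let $A_{n-1}=\mathbb C[t_1^{\pm1},\dots,t_{n-1}^{\pm1}]$ and $J=\mathcal G_{\rm aff}\otimes A_{n-1}$ with bracket $[x\otimes f,y\otimes g]=[x,y]\otimes fg$. Let $D=\bigoplus_{i=1}^n\mathbb C d_i$ be abelian and let it act on $J$ by the degree derivations $d_i=t_i\,\partial/\partial t_i$ (all $d_i$ with $i<n$ acting on $A_{n-1}$, $d_n$ acting on $\mathcal G_{\rm aff}$ with $d_nK_n=0$), and form the Lie algebra $J\oplus D$ and its subalgebra $J\oplus\mathbb C d_n$. Put $h_0=h\oplus\mathbb C K_n\oplus D$ and $h_{n-1}=h\oplus\mathbb C K_n\oplus\mathbb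 C d_n$. Let $V$ be an irreducible $J\oplus D$-module which is a weight module with finite-dimensional weight spaces with respect to $h_0$. A linear operator $z:V\to V$ is called a central operator of degree $\underline k\in\mathbb Z^n$ if it commutes with the action of $J$ and $d_iz-zd_i=k_iz$ on $V$ for $i=1,\dots,n$. Let $z_1,\dots,z_{n-1}$ be non-zero central operators on $V$ that commute with one another (as is automatic for operators obtained from the action of the centre of $J$ by sums, products and inverses), $z_i$ being of degree $k_ie_i$ for some non-zero integer $k_i$, where $e_1,\dots,e_n$ is the standard basis of $\mathbb Z^n$. Then $V$ has a maximal $J\oplus\mathbb C d_n$-submodule $W$ such that $V/W$ is an irreducible $J\oplus\mathbb C d_n$-module and is a weight module with finite-dimensional weight spaces with respect to $h_{n-1}$. Moreover, $W$ can be chosen to contain $z_iv-v$ for all $v\in V$ and $1\le i\le n-1$. -/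

import Mathlib

open scoped TensorProduct

noncomputable section

namespace Toroidal

open LieAlgebra LieModule

/-! ### Degree operators on Laurent polynomials and on the loop algebra -/

section Degree

variable {M : Type*} [AddCommGroup M]

/-- The linear operator `t^r ↦ φ(r) t^r` on the group algebra `ℂ[M]`. -/
def degOp (φ : M →+ ℂ) : AddMonoidAlgebra ℂ M →ₗ[ℂ] AddMonoidAlgebra ℂ M :=
  (AddMonoidAlgebra.basis M ℂ).constr ℂ fun r => φ r • AddMonoidAlgebra.single r (1 : ℂ)

@[simp]
theorem degOp_single (φ : M →+ ℂ) (r : M) (c : ℂ) :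
    degOp φ (AddMonoidAlgebra.single r c) = φ r • AddMonoidAlgebra.single r c := by
  have h : AddMonoidAlgebra.single r c = c • AddMonoidAlgebra.basis M ℂ r := by
    simp [AddMonoidAlgebra.basis_apply]
  rw [h, map_smul, degOp, Module.Basis.constr_basis, AddMonoidAlgebra.basis_apply, smul_comm]

theorem degOp_mul (φ : M →+ ℂ) (f g : AddMonoidAlgebra ℂ M) :
    degOp φ (f * g) = degOp φ f * g + f * degOp φ g := by
  induction f using AddMonoidAlgebra.induction_linear with
  | zero => simp
  | add f₁ f₂ h₁ h₂ => simp only [add_mul, map_add, h₁, h₂]; abel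
  | single r a =>
    induction g using AddMonoidAlgebra.induction_linear with
    | zero => simp
    | add g₁ g₂ h₁ h₂ => simp only [mul_add, map_add, h₁, h₂]; abel
    | single s b =>
      simp only [degOp_single, AddMonoidAlgebra.single_mul_single, map_add, add_smul,
        smul_mul_assoc, mul_smul_comm]

end Degree

/-! ### Derivations of `A ⊗ L` -/

section Deriv

/-- `T` is a derivation of the Lie algebra `L`. -/
def IsLieDeriv {L : Type*} [LieRing L] [LieAlgebra ℂ L] (T : L →ₗ[ℂ] L) : Prop :=
  ∀ x y : L, T ⁅x, y⁆ = ⁅T x, y⁆ + ⁅x, T y⁆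

variable {L : Type*} [LieRing L] [LieAlgebra ℂ L] {A : Type*} [CommRing A] [Algebra ℂ A]

theorem IsLieDeriv.add {S T : L →ₗ[ℂ] L} (hS : IsLieDeriv S) (hT : IsLieDeriv T) :
    IsLieDeriv (S + T) := by
  intro x y
  simp only [LinearMap.add_apply, hS x y, hT x y, add_lie, lie_add]
  abel

theorem IsLieDeriv.smul {T : L →ₗ[ℂ] L} (hT : IsLieDeriv T) (c : ℂ) :
    IsLieDeriv (c • T) := by
  intro x y
  simp only [LinearMap.smul_apply, hT x y, smul_lie, lie_smul, smul_add]

theorem isLieDeriv_of_tmul (T : A ⊗[ℂ] L →ₗ[ℂ] A ⊗[ℂ] L)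
    (h : ∀ (f g : A) (u v : L), T ((f * g) ⊗ₜ[ℂ] ⁅u, v⁆) =
      ⁅T (f ⊗ₜ[ℂ] u), g ⊗ₜ[ℂ] v⁆ + ⁅f ⊗ₜ[ℂ] u, T (g ⊗ₜ[ℂ] v)⁆) :
    IsLieDeriv T := by
  intro x y
  induction x using TensorProduct.induction_on with
  | zero => simp only [zero_lie, map_zero, add_zero]
  | add x₁ x₂ h₁ h₂ => simp only [add_lie, map_add, h₁, h₂]; abel
  | tmul f u =>
    induction y using TensorProduct.induction_on with
    | zero => simp only [lie_zero, map_zero, add_zero]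
    | add y₁ y₂ h₁ h₂ => simp only [lie_add, map_add, h₁, h₂]; abel
    | tmul g v => exact h f g u v

theorem isLieDeriv_rTensor (E : A →ₗ[ℂ] A) (hE : ∀ f g, E (f * g) = E f * g + f * E g) :
    IsLieDeriv (LinearMap.rTensor L E : A ⊗[ℂ] L →ₗ[ℂ] A ⊗[ℂ] L) :=
  isLieDeriv_of_tmul _ fun f g u v => by
    simp only [LinearMap.rTensor_tmul, ExtendScalars.bracket_tmul, hE, TensorProduct.add_tmul]

theorem isLieDeriv_lTensor (F : L →ₗ[ℂ] L) (hF : IsLieDeriv F) :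
    IsLieDeriv (LinearMap.lTensor A F : A ⊗[ℂ] L →ₗ[ℂ] A ⊗[ℂ] L) :=
  isLieDeriv_of_tmul _ fun f g u v => by
    simp only [LinearMap.lTensor_tmul, ExtendScalars.bracket_tmul, hF u v, TensorProduct.tmul_add]

end Deriv

/-! ### The affine algebra `𝔤 ⊗ ℂ[t, t⁻¹] ⊕ ℂK` -/

section Affine

variable {𝔤 : Type*} [LieRing 𝔤] [LieAlgebra ℂ 𝔤]
variable (B : LinearMap.BilinForm ℂ 𝔤) (hB : B.lieInvariant 𝔤) (hS : B.IsSymm)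

/-- The cocycle `(X ⊗ t^r, Y ⊗ t^s) ↦ r δ_{r+s,0} B(X, Y)`.  (Mathlib's cocycle is
`s δ_{r+s,0} B(X, Y)`, hence the sign.) -/
def affineCocycle :
    Cohomology.twoCocycle ℂ (loopAlgebra ℂ ℤ 𝔤) (TrivialLieModule ℂ (loopAlgebra ℂ ℤ 𝔤) ℂ) :=
  (-1 : ℂ) • LoopAlgebra.twoCocycleOfBilinear ℂ ℤ 𝔤 B hB hS

/-- The affine Lie algebra `𝔤_aff = 𝔤 ⊗ ℂ[t, t⁻¹] ⊕ ℂK`, with `K` central and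
`[X ⊗ t^r, Y ⊗ t^s] = [X, Y] ⊗ t^(r+s) + r δ_{r+s,0} B(X, Y) K`. -/
abbrev Aff := ofTwoCocycle (affineCocycle B hB hS)

/-- The element `X ⊗ t^s` of the affine algebra. -/
def Aff.x (s : ℤ) (X : 𝔤) : Aff B hB hS :=
  ofProd _ (AddMonoidAlgebra.single s (1 : ℂ) ⊗ₜ[ℂ] X, 0)

/-- The central element `K` of the affine algebra. -/
def Aff.K : Aff B hB hS :=
  ofProd _ (0, (TrivialLieModule.equiv ℂ (loopAlgebra ℂ ℤ 𝔤) ℂ).symm 1)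

theorem affineCocycle_apply (f g : loopAlgebra ℂ ℤ 𝔤) :
    (affineCocycle B hB hS).1.1 f g =
      -(TrivialLieModule.equiv ℂ (loopAlgebra ℂ ℤ 𝔤) ℂ).symm
        (LoopAlgebra.residuePairing ℂ ℤ 𝔤 B f g) := by
  simp [affineCocycle]

/-- The operator `t d/dt` on the loop algebra `ℂ[t, t⁻¹] ⊗ 𝔤`. -/
def loopDeg (𝔤 : Type*) [LieRing 𝔤] [LieAlgebra ℂ 𝔤] :
    loopAlgebra ℂ ℤ 𝔤 →ₗ[ℂ] loopAlgebra ℂ ℤ 𝔤 :=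
  LinearMap.rTensor 𝔤 (degOp (Int.castAddHom ℂ))

theorem loopDeg_tmul (s : ℤ) (c : ℂ) (X : 𝔤) :
    loopDeg 𝔤 (AddMonoidAlgebra.single s c ⊗ₜ[ℂ] X) =
      (s : ℂ) • (AddMonoidAlgebra.single s c ⊗ₜ[ℂ] X) := by
  rw [loopDeg, LinearMap.rTensor_tmul, degOp_single, TensorProduct.smul_tmul']
  rfl

/-- Induction on the loop algebra through the elements `t^s ⊗ X`. -/
theorem loop_induction {P : loopAlgebra ℂ ℤ 𝔤 → Prop} (f : loopAlgebra ℂ ℤ 𝔤) (h0 : P 0)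
    (h1 : ∀ (s : ℤ) (X : 𝔤), P (AddMonoidAlgebra.single s (1 : ℂ) ⊗ₜ[ℂ] X))
    (h2 : ∀ f g, P f → P g → P (f + g)) : P f := by
  induction f using TensorProduct.induction_on with
  | zero => exact h0
  | add f g hf hg => exact h2 f g hf hg
  | tmul p X =>
    induction p using AddMonoidAlgebra.induction_linear with
    | zero => simpa using h0
    | add p q hp hq => rw [TensorProduct.add_tmul]; exact h2 _ _ hp hq
    | single s c =>
      have : (AddMonoidAlgebra.single s c : AddMonoidAlgebra ℂ ℤ) ⊗ₜ[ℂ] X =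
          AddMonoidAlgebra.single s (1 : ℂ) ⊗ₜ[ℂ] (c • X) := by
        rw [← TensorProduct.smul_tmul, AddMonoidAlgebra.smul_single, smul_eq_mul, mul_one]
      rw [this]; exact h1 s _

theorem loopDeg_lie : IsLieDeriv (loopDeg 𝔤) :=
  isLieDeriv_rTensor _ (degOp_mul _)

theorem residuePairing_tmul (r s : ℤ) (X Y : 𝔤) :
    LoopAlgebra.residuePairing ℂ ℤ 𝔤 B (AddMonoidAlgebra.single r (1 : ℂ) ⊗ₜ[ℂ] X)
      (AddMonoidAlgebra.single s (1 : ℂ) ⊗ₜ[ℂ] Y) =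
        if r + s = 0 then (s : ℂ) * B X Y else 0 := by
  rw [LoopAlgebra.residuePairing_apply_apply, LoopAlgebra.toFinsupp_single_tmul,
    LoopAlgebra.toFinsupp_single_tmul, Finsupp.sum_single_index (by simp)]
  split_ifs with h
  · obtain rfl : r = -s := by omega
    simp
  · rw [Finsupp.single_eq_of_ne (by omega)]
    simp

theorem Aff.lie_x_x (r s : ℤ) (X Y : 𝔤) :
    ⁅Aff.x B hB hS r X, Aff.x B hB hS s Y⁆ =
      Aff.x B hB hS (r + s) ⁅X, Y⁆ +
        (if r + s = 0 then (r : ℂ) * B X Y else 0) • Aff.K B hB hS := by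
  have h : (affineCocycle B hB hS).1.1 (AddMonoidAlgebra.single r (1 : ℂ) ⊗ₜ[ℂ] X)
      (AddMonoidAlgebra.single s (1 : ℂ) ⊗ₜ[ℂ] Y) =
        (if r + s = 0 then (r : ℂ) * B X Y else 0) •
          (TrivialLieModule.equiv ℂ (loopAlgebra ℂ ℤ 𝔤) ℂ).symm 1 := by
    rw [affineCocycle_apply, residuePairing_tmul, ← map_neg, ← map_smul]
    congr 1
    split_ifs with h
    · obtain rfl : r = -s := by omega
      simp
    · simp
  simp only [bracket_ofTwoCocycle, Aff.x, Aff.K, Equiv.symm_apply_apply, h, trivial_lie_zero,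
    add_zero, sub_zero, ← of_smul, ← of_add, Prod.smul_mk, smul_zero, Prod.mk_add_mk, zero_add,
    ExtendScalars.bracket_tmul, AddMonoidAlgebra.single_mul_single, mul_one]

theorem Aff.lie_K (y : Aff B hB hS) : ⁅Aff.K B hB hS, y⁆ = 0 := by
  simp only [bracket_ofTwoCocycle, Aff.K, Equiv.symm_apply_apply, trivial_lie_zero, zero_lie,
    map_zero, LinearMap.zero_apply, add_zero, sub_zero]
  rfl

theorem residuePairing_loopDeg (f g : loopAlgebra ℂ ℤ 𝔤) :
    LoopAlgebra.residuePairing ℂ ℤ 𝔤 B (loopDeg 𝔤 f) g +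
      LoopAlgebra.residuePairing ℂ ℤ 𝔤 B f (loopDeg 𝔤 g) = 0 := by
  induction f using loop_induction with
  | h0 => simp
  | h2 f₁ f₂ h₁ h₂ =>
    simp only [map_add, LinearMap.add_apply]
    linear_combination h₁ + h₂
  | h1 r X =>
    induction g using loop_induction with
    | h0 => simp
    | h2 g₁ g₂ h₁ h₂ =>
      simp only [map_add]
      linear_combination h₁ + h₂
    | h1 s Y =>
      simp only [loopDeg_tmul, map_smul, LinearMap.smul_apply, residuePairing_tmul]
      split_ifs with h
      · obtain rfl : r = -s := by omega
        simp
      · simp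

/-- The degree derivation `t d/dt` of the affine algebra: `X ⊗ t^s ↦ s X ⊗ t^s`, `K ↦ 0`. -/
def affDeg : Aff B hB hS →ₗ[ℂ] Aff B hB hS where
  toFun x := ofProd _ (loopDeg 𝔤 ((ofProd _).symm x).1, 0)
  map_add' x y := by simp [← of_add]
  map_smul' c x := by simp [← of_smul]

theorem affDeg_x (s : ℤ) (X : 𝔤) :
    affDeg B hB hS (Aff.x B hB hS s X) = (s : ℂ) • Aff.x B hB hS s X := by
  change ofProd _ (loopDeg 𝔤 (AddMonoidAlgebra.single s (1 : ℂ) ⊗ₜ[ℂ] X), 0) = _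
  rw [loopDeg_tmul, Aff.x, ← of_smul, Prod.smul_mk, smul_zero]

theorem affDeg_K : affDeg B hB hS (Aff.K B hB hS) = 0 := by
  simp [affDeg, Aff.K]
  rfl

theorem affDeg_lie : IsLieDeriv (affDeg B hB hS) := by
  intro x y
  have h := residuePairing_loopDeg B ((ofProd _).symm x).1 ((ofProd _).symm y).1
  have h' : (affineCocycle B hB hS).1.1 (loopDeg 𝔤 ((ofProd _).symm x).1) ((ofProd _).symm y).1 +
      (affineCocycle B hB hS).1.1 ((ofProd _).symm x).1 (loopDeg 𝔤 ((ofProd _).symm y).1) = 0 := by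
    rw [affineCocycle_apply, affineCocycle_apply, ← neg_add, ← map_add, h, map_zero, neg_zero]
  simp only [bracket_ofTwoCocycle, affDeg, LinearMap.coe_mk, AddHom.coe_mk,
    Equiv.symm_apply_apply, ← of_add, trivial_lie_zero, add_zero, sub_zero, Prod.mk_add_mk, h',
    loopDeg_lie ((ofProd _).symm x).1 ((ofProd _).symm y).1]

end Affine

/-! ### The algebra `J = 𝔤_aff ⊗ A_m` and its degree derivations -/

/-- The ring `A_m = ℂ[t₁^{±1}, …, t_m^{±1}]`. -/
abbrev Laurent (m : ℕ) := AddMonoidAlgebra ℂ (Fin m → ℤ)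

/-- The abelian Lie algebra `D` with basis `d₁, …, d_{m+1}`. -/
def DegAlg (m : ℕ) : Type := Fin (m + 1) → ℂ

namespace DegAlg

variable {m : ℕ}

instance : AddCommGroup (DegAlg m) := inferInstanceAs (AddCommGroup (Fin (m + 1) → ℂ))

instance : Module ℂ (DegAlg m) := inferInstanceAs (Module ℂ (Fin (m + 1) → ℂ))

instance : LieRing (DegAlg m) where
  bracket _ _ := 0
  add_lie _ _ _ := by simp
  lie_add _ _ _ := by simp
  lie_self _ := rfl
  leibniz_lie _ _ _ := by simp

instance : LieAlgebra ℂ (DegAlg m) where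
  lie_smul c _ _ := (smul_zero c).symm

/-- The basis vector `d_i`. -/
def d (i : Fin (m + 1)) : DegAlg m := (Pi.single i 1 : Fin (m + 1) → ℂ)

/-- The `i`-th coordinate on `D`. -/
def coord (i : Fin (m + 1)) : DegAlg m →ₗ[ℂ] ℂ := LinearMap.proj (φ := fun _ => ℂ) i

theorem coord_d (i j : Fin (m + 1)) : coord j (d i) = if j = i then 1 else 0 := by
  change (Pi.single i 1 : Fin (m + 1) → ℂ) j = _
  rw [Pi.single_apply]

/-- The additive map `r ↦ ∑_{i ≤ m} a_i r_i` attached to `a = ∑ a_i d_i`. -/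
def pairing (a : DegAlg m) : (Fin m → ℤ) →+ ℂ where
  toFun r := ∑ i : Fin m, coord i.castSucc a * (r i : ℂ)
  map_zero' := by simp
  map_add' r s := by simp [mul_add, Finset.sum_add_distrib]

end DegAlg

section Multiloop

variable {𝔤 : Type*} [LieRing 𝔤] [LieAlgebra ℂ 𝔤] (m : ℕ)
variable (B : LinearMap.BilinForm ℂ 𝔤) (hB : B.lieInvariant 𝔤) (hS : B.IsSymm)

/-- `J = 𝔤_aff ⊗ A_m`, with bracket `[f ⊗ x, g ⊗ y] = fg ⊗ [x, y]`; the variable of `𝔤_aff`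
plays the role of `t_{m+1}`. -/
abbrev J := Laurent m ⊗[ℂ] Aff B hB hS

variable {m}

/-- The operator on `J` by which `a = ∑ a_i d_i ∈ D` acts: on `t^r ⊗ (X ⊗ t_{m+1}^s)` it is
multiplication by `∑_{i ≤ m} a_i r_i + a_{m+1} s`, and on `t^r ⊗ K` by `∑_{i ≤ m} a_i r_i`. -/
def degJ (a : DegAlg m) : J m B hB hS →ₗ[ℂ] J m B hB hS :=
  LinearMap.rTensor _ (degOp a.pairing) +
    DegAlg.coord (Fin.last m) a • LinearMap.lTensor _ (affDeg B hB hS)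

theorem degJ_tmul (a : DegAlg m) (r : Fin m → ℤ) (c : ℂ) (x : Aff B hB hS) :
    degJ B hB hS a (AddMonoidAlgebra.single r c ⊗ₜ[ℂ] x) =
      AddMonoidAlgebra.single r c ⊗ₜ[ℂ]
        (a.pairing r • x + DegAlg.coord (Fin.last m) a • affDeg B hB hS x) := by
  rw [degJ, LinearMap.add_apply, LinearMap.smul_apply, LinearMap.rTensor_tmul,
    LinearMap.lTensor_tmul, degOp_single, TensorProduct.tmul_add, TensorProduct.tmul_smul,
    TensorProduct.tmul_smul]
  rfl

/-- Induction on `J` through the elements `t^r ⊗ x`. -/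
theorem J_induction {P : J m B hB hS → Prop} (y : J m B hB hS) (h0 : P 0)
    (h1 : ∀ (r : Fin m → ℤ) (c : ℂ) (x : Aff B hB hS), P (AddMonoidAlgebra.single r c ⊗ₜ[ℂ] x))
    (h2 : ∀ f g, P f → P g → P (f + g)) : P y := by
  induction y using TensorProduct.induction_on with
  | zero => exact h0
  | add f g hf hg => exact h2 f g hf hg
  | tmul p X =>
    induction p using AddMonoidAlgebra.induction_linear with
    | zero => rw [TensorProduct.zero_tmul]; exact h0
    | add p q hp hq => rw [TensorProduct.add_tmul]; exact h2 _ _ hp hq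
    | single s c => exact h1 s c X

theorem degJ_lie (a : DegAlg m) : IsLieDeriv (degJ B hB hS a) :=
  (isLieDeriv_rTensor _ (degOp_mul _)).add ((isLieDeriv_lTensor _ (affDeg_lie B hB hS)).smul _)

theorem degJ_comm (a b : DegAlg m) (x : J m B hB hS) :
    degJ B hB hS a (degJ B hB hS b x) = degJ B hB hS b (degJ B hB hS a x) := by
  induction x using J_induction with
  | h0 => simp only [map_zero]
  | h2 x₁ x₂ h₁ h₂ => simp only [map_add, h₁, h₂]
  | h1 r c x =>
    simp only [degJ_tmul]
    congr 1
    simp only [map_add, map_smul]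
    module

theorem degJ_add (a b : DegAlg m) (x : J m B hB hS) :
    degJ B hB hS (a + b) x = degJ B hB hS a x + degJ B hB hS b x := by
  induction x using J_induction with
  | h0 => simp only [map_zero, add_zero]
  | h2 x₁ x₂ h₁ h₂ => simp only [map_add, h₁, h₂]; abel
  | h1 r c x =>
    simp only [degJ_tmul, ← TensorProduct.tmul_add]
    congr 1
    have : (a + b).pairing r = a.pairing r + b.pairing r := by
      simp [DegAlg.pairing, add_mul, Finset.sum_add_distrib]
    rw [this, map_add]
    module

theorem degJ_smul (t : ℂ) (a : DegAlg m) (x : J m B hB hS) :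
    degJ B hB hS (t • a) x = t • degJ B hB hS a x := by
  induction x using J_induction with
  | h0 => simp only [map_zero, smul_zero]
  | h2 x₁ x₂ h₁ h₂ => simp only [map_add, h₁, h₂, smul_add]
  | h1 r c x =>
    simp only [degJ_tmul, ← TensorProduct.tmul_smul]
    congr 1
    have : (t • a).pairing r = t * a.pairing r := by
      simp [DegAlg.pairing, Finset.mul_sum, mul_assoc]
    rw [this, map_smul, smul_eq_mul]
    module

/-- The action of `D` on `J` by derivations. -/
def degAction : DegAlg m →ₗ⁅ℂ⁆ LieDerivation ℂ (J m B hB hS) (J m B hB hS) where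
  toFun a :=
    { toLinearMap := degJ B hB hS a
      leibniz' := fun x y => by
        rw [degJ_lie B hB hS a x y, ← lie_skew y, sub_neg_eq_add, add_comm] }
  map_add' a b := LieDerivation.ext fun x => degJ_add B hB hS a b x
  map_smul' c a := LieDerivation.ext fun x => degJ_smul B hB hS c a x
  map_lie' {a b} := LieDerivation.ext fun x => by
    rw [LieDerivation.commutator_apply]
    change degJ B hB hS 0 x = degJ B hB hS a (degJ B hB hS b x) - degJ B hB hS b (degJ B hB hS a x)
    rw [degJ_comm, sub_self, ← zero_smul ℂ (0 : DegAlg m), degJ_smul, zero_smul]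

variable (m)

/-- The Lie algebra `J ⊕ D`. -/
abbrev JD := J m B hB hS ⋊⁅degAction B hB hS⁆ DegAlg m

variable {m}

/-- The inclusion `J → J ⊕ D`. -/
abbrev JD.ofJ : J m B hB hS →ₗ⁅ℂ⁆ JD m B hB hS := SemiDirectSum.inl _

/-- The element `d_i` of `J ⊕ D`. -/
abbrev JD.d (i : Fin (m + 1)) : JD m B hB hS := SemiDirectSum.inr _ (DegAlg.d i)

theorem JD.lie_d_ofJ (i : Fin (m + 1)) (x : J m B hB hS) :
    ⁅JD.d B hB hS i, JD.ofJ B hB hS x⁆ = JD.ofJ B hB hS (degJ B hB hS (DegAlg.d i) x) := by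
  ext
  · change ⁅(0 : J m B hB hS), x⁆ + degJ B hB hS (DegAlg.d i) x -
      degJ B hB hS (0 : DegAlg m) 0 = degJ B hB hS (DegAlg.d i) x
    rw [map_zero, sub_zero]
    exact (congrArg (· + _) (zero_lie x)).trans (zero_add _)
  · rfl

/-- The element `X` of `𝔤 ⊆ J ⊆ J ⊕ D`. -/
def JD.ofLie (X : 𝔤) : JD m B hB hS := JD.ofJ B hB hS (1 ⊗ₜ[ℂ] Aff.x B hB hS 0 X)

/-- The element `K_{m+1}` of `J ⊕ D`. -/
def JD.K : JD m B hB hS := JD.ofJ B hB hS (1 ⊗ₜ[ℂ] Aff.K B hB hS)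

variable (m)

/-- The subalgebra `J ⊕ ℂ d_{m+1}` of `J ⊕ D`. -/
def JDlast : LieSubalgebra ℂ (JD m B hB hS) where
  carrier := {x | ∀ i : Fin m, DegAlg.coord i.castSucc x.right = 0}
  add_mem' {x y} hx hy i := by
    rw [SemiDirectSum.add_eq_mk, map_add, hx i, hy i, add_zero]
  zero_mem' i := map_zero _
  smul_mem' c x hx i := by
    rw [SemiDirectSum.smul_eq_mk, map_smul, hx i, smul_zero]
  lie_mem' {x y} _ _ i := map_zero (DegAlg.coord i.castSucc)

variable {m}

/-- The subspace `𝔥 ⊕ ℂ K_{m+1} ⊕ ∑_{i ∈ S} ℂ d_i` of `J ⊕ D`. -/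
def cartan (H : LieSubalgebra ℂ 𝔤) (S : Set (Fin (m + 1))) : Submodule ℂ (JD m B hB hS) :=
  Submodule.span ℂ
    (JD.ofLie B hB hS '' (H : Set 𝔤) ∪ {JD.K B hB hS} ∪ JD.d B hB hS '' S)

theorem cartan_last_le (H : LieSubalgebra ℂ 𝔤) :
    cartan B hB hS H {Fin.last m} ≤ (JDlast m B hB hS).toSubmodule := by
  refine Submodule.span_le.mpr ?_
  rintro x ((⟨X, -, rfl⟩ | rfl) | ⟨j, rfl, rfl⟩) i
  · exact map_zero _
  · exact map_zero _
  · exact Pi.single_eq_of_ne (Fin.castSucc_lt_last i).ne 1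

/-- The subspace `𝔥 ⊕ ℂ K_{m+1} ⊕ ℂ d_{m+1}` of `J ⊕ ℂ d_{m+1}`. -/
def cartanLast (H : LieSubalgebra ℂ 𝔤) : Submodule ℂ (JDlast m B hB hS) :=
  (cartan B hB hS H {Fin.last m}).comap (JDlast m B hB hS).toSubmodule.subtype

end Multiloop

/-! ### Weight modules and central operators -/

section Weights

variable {L : Type*} [LieRing L] [LieAlgebra ℂ L]
variable (V : Type*) [AddCommGroup V] [Module ℂ V] [LieRingModule L V] [LieModule ℂ L V]

/-- The weight space of `V` of weight `lam` with respect to a subspace `T` of `L`. -/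
def weightSpace (T : Submodule ℂ L) (lam : T →ₗ[ℂ] ℂ) : Submodule ℂ V where
  carrier := {v | ∀ x : T, ⁅(x : L), v⁆ = lam x • v}
  add_mem' {v w} hv hw x := by rw [lie_add, hv x, hw x, smul_add]
  zero_mem' x := by simp
  smul_mem' c v hv x := by rw [lie_smul, hv x, smul_comm]

/-- `V` is a weight module with finite-dimensional weight spaces with respect to `T`: it is
spanned by its weight spaces (whose sum is always direct), and each of them is
finite-dimensional. -/
def IsFiniteWeightModule (T : Submodule ℂ L) : Prop :=
  (⨆ lam : T →ₗ[ℂ] ℂ, weightSpace V T lam) = ⊤ ∧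
    ∀ lam : T →ₗ[ℂ] ℂ, FiniteDimensional ℂ (weightSpace V T lam)

end Weights

/-- `z` is a central operator of degree `k ∈ ℤ^{m+1}` on the `J ⊕ D`-module `V`: it commutes with
the action of `J`, and `[d_i, z] = k_i z` for all `i`. -/
structure IsCentralOperator {𝔤 : Type*} [LieRing 𝔤] [LieAlgebra ℂ 𝔤] {m : ℕ}
    (B : LinearMap.BilinForm ℂ 𝔤) (hB : B.lieInvariant 𝔤) (hS : B.IsSymm)
    {V : Type*} [AddCommGroup V] [Module ℂ V] [LieRingModule (JD m B hB hS) V]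
    (z : V →ₗ[ℂ] V) (k : Fin (m + 1) → ℤ) : Prop where
  comm : ∀ (x : J m B hB hS) (v : V), z ⁅JD.ofJ B hB hS x, v⁆ = ⁅JD.ofJ B hB hS x, z v⁆
  degree : ∀ (i : Fin (m + 1)) (v : V),
    ⁅JD.d B hB hS i, z v⁆ - z ⁅JD.d B hB hS i, v⁆ = (k i : ℂ) • z v

end Toroidal

end

/-!
The central operators `z i` are invertible: their kernels and images are stable under `J` and `D`,
and `V` is irreducible (`IsCentralOperator.bijective`). They commute with `J ⊕ ℂ d_{m+1}` and move
the eigenvalue of `d_i` by `k i ≠ 0`. So `W₀ = ∑ i, (z i - 1) V` is a `J ⊕ ℂ d_{m+1}`-submodule, and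
`V / W₀` arises from `V` by identifying the eigenspaces of `(d_1, …, d_m)` along the lattice
`∏ i, k i ℤ`. This has the following consequences.

* `W₀ ≠ V` (`iSup_range_sub_one_ne_top`): sending each simultaneous eigenvector of the `d_i` to its
  translate, by a monomial in the `z i`, whose eigenvalues lie in a fixed fundamental domain defines
  a non-zero operator on `V` that vanishes on `W₀`.
* Maximal submodules above `W₀` exist, because `V` is cyclic, hence finitely generated, already over
  `J ⊕ ℂ d_{m+1}` (`lieSpan_eq_top`). Any one of them can serve as `W`.
* The weight spaces of `V / W` are finite-dimensional (`isFiniteWeightModule_quotient`). By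
  irreducibility the eigenvalues of `(d_1, …, d_m)` on `V` lie in one coset `c + ℤ^m`
  (`iSup_jointEigenspace_coset`). Modulo `W` only the finitely many `c + r` with `0 ≤ r i < |k i|`
  are needed, so the weight space of `V / W` of a given weight is the image of finitely many weight
  spaces of `V`. That the image is the whole weight space follows from the independence of the
  weight spaces of `V / W` (`iSupIndep.eq_of_le_of_iSup_eq_top`).
-/

noncomputable section

/-! ### Simultaneous eigenspaces -/

/-- In a modular lattice, an independent family cannot be shrunk without shrinking its supremum. -/
theorem iSupIndep.eq_of_le_of_iSup_eq_top {α κ : Type*} [CompleteLattice α] [IsModularLattice α]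
    {f g : κ → α} (hf : iSupIndep f) (hgf : ∀ i, g i ≤ f i) (hg : ⨆ i, g i = ⊤) (i : κ) :
    g i = f i := by
  have h1 : g i ⊔ ⨆ (j) (_ : j ≠ i), g j = ⊤ := by
    rw [← hg]
    refine le_antisymm (sup_le (le_iSup g i) (iSup₂_le fun j _ => le_iSup g j))
      (iSup_le fun j => ?_)
    by_cases hj : j = i
    · rw [hj]; exact le_sup_left
    · exact le_sup_of_le_right (le_iSup₂ (f := fun j (_ : j ≠ i) => g j) j hj)
  have h2 : (⨆ (j) (_ : j ≠ i), g j) ⊓ f i = ⊥ :=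
    ((hf i).symm.mono_left (iSup₂_mono fun j _ => hgf j)).eq_bot
  have h3 := sup_inf_assoc_of_le (⨆ (j) (_ : j ≠ i), g j) (hgf i)
  rw [h1, h2, top_inf_eq, sup_bot_eq] at h3
  exact h3.symm

namespace Toroidal

section Linear

variable {ι V : Type*} [AddCommGroup V] [Module ℂ V]

/-- The simultaneous eigenspace of a family of operators, with eigenvalues `χ`. -/
def jointEigenspace (D : ι → Module.End ℂ V) (χ : ι → ℂ) : Submodule ℂ V :=
  ⨅ i, (D i).eigenspace (χ i)

theorem mem_jointEigenspace {D : ι → Module.End ℂ V} {χ : ι → ℂ} {v : V} :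
    v ∈ jointEigenspace D χ ↔ ∀ i, D i v = χ i • v := by
  simp [jointEigenspace, Submodule.mem_iInf]

theorem iSupIndep_jointEigenspace {D : ι → Module.End ℂ V} (hD : ∀ i j, Commute (D i) (D j)) :
    iSupIndep (jointEigenspace D) :=
  (Module.End.independent_iInf_maxGenEigenspace_of_forall_mapsTo D fun i j φ =>
    Module.End.mapsTo_maxGenEigenspace_of_comm (hD j i) φ).mono fun _ =>
      iInf_mono fun _ => (Module.End.genEigenspace _ _).mono le_top

/-! ### Monomials in commuting invertible operators -/

variable [Fintype ι] [DecidableEq ι]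

/-- The operator `∏ i, u i ^ q i` for pairwise commuting invertible operators `u i`, as a
homomorphism in the exponent `q`. -/
def monomialOp (u : ι → V ≃ₗ[ℂ] V) (hu : ∀ i j, Commute (u i) (u j)) :
    (ι → Multiplicative ℤ) →* (V ≃ₗ[ℂ] V) :=
  MonoidHom.noncommPiCoprod (fun i => zpowersHom (V ≃ₗ[ℂ] V) (u i)) <| by
    intro i j _ x y
    simpa using ((hu i j).zpow_left _).zpow_right _

/-- The exponent `e_i`. -/
abbrev unitExp (i : ι) : ι → Multiplicative ℤ := Pi.mulSingle i (Multiplicative.ofAdd 1)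

theorem monomialOp_unitExp (u : ι → V ≃ₗ[ℂ] V) (hu : ∀ i j, Commute (u i) (u j)) (i : ι) :
    monomialOp u hu (unitExp i) = u i := by
  exact (MonoidHom.noncommPiCoprod_mulSingle _ _ _).trans (by simp)

theorem mem_of_unitExp_mem (S : Subgroup (ι → Multiplicative ℤ)) (h : ∀ i, unitExp i ∈ S)
    (q : ι → Multiplicative ℤ) : q ∈ S := by
  rw [← Finset.univ_prod_mulSingle q]
  refine S.prod_mem fun i _ => ?_
  have : Pi.mulSingle i (q i) = (unitExp i : ι → Multiplicative ℤ) ^ (q i).toAdd := by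
    rw [unitExp, ← Pi.mulSingle_zpow, ← ofAdd_zsmul]
    simp
  rw [this]
  exact S.zpow_mem (h i) _

variable {u : ι → V ≃ₗ[ℂ] V} (hu : ∀ i j, Commute (u i) (u j))

theorem monomialOp_commute {T : Module.End ℂ V} (hT : ∀ i v, T (u i v) = u i (T v))
    (q : ι → Multiplicative ℤ) (v : V) : T (monomialOp u hu q v) = monomialOp u hu q (T v) := by
  revert v
  refine mem_of_unitExp_mem
    { carrier := {q | ∀ v, T (monomialOp u hu q v) = monomialOp u hu q (T v)}
      mul_mem' := fun {a b} ha hb v => ?_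
      one_mem' := fun v => ?_
      inv_mem' := fun {a} ha v => ?_ } (fun i v => ?_) q
  · simp only [map_mul, LinearEquiv.mul_apply, ha _, hb _]
  · simp
  · rw [map_inv, ← (monomialOp u hu a).symm_apply_apply (T _)]
    change (monomialOp u hu a).symm (monomialOp u hu a (T ((monomialOp u hu a).symm v))) =
      (monomialOp u hu a).symm (T v)
    rw [← ha, LinearEquiv.apply_symm_apply]
  · rw [monomialOp_unitExp, hT]

theorem monomialOp_shift {T : Module.End ℂ V} {j : ι} {κ : ℂ}
    (hT : ∀ i v, T (u i v) = u i (T v) + (if i = j then κ else 0) • u i v)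
    (q : ι → Multiplicative ℤ) (v : V) :
    T (monomialOp u hu q v) =
      monomialOp u hu q (T v) + (κ * ((q j).toAdd : ℂ)) • monomialOp u hu q v := by
  revert v
  refine mem_of_unitExp_mem
    { carrier := {q | ∀ v, T (monomialOp u hu q v) =
        monomialOp u hu q (T v) + (κ * ((q j).toAdd : ℂ)) • monomialOp u hu q v}
      mul_mem' := fun {a b} ha hb v => ?_
      one_mem' := fun v => ?_
      inv_mem' := fun {a} ha v => ?_ } (fun i v => ?_) q
  · simp only [map_mul, LinearEquiv.mul_apply, ha _, hb _, map_add, map_smul, Pi.mul_apply,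
      toAdd_mul, Int.cast_add, mul_add, add_smul]
    abel
  · simp
  · have h := ha ((monomialOp u hu a).symm v)
    rw [LinearEquiv.apply_symm_apply] at h
    rw [map_inv]
    change T ((monomialOp u hu a).symm v) = (monomialOp u hu a).symm (T v) +
      (κ * (((a j)⁻¹).toAdd : ℂ)) • (monomialOp u hu a).symm v
    rw [h, map_add, map_smul, LinearEquiv.symm_apply_apply, toAdd_inv]
    push_cast
    module
  · rw [monomialOp_unitExp, hT]
    by_cases hij : i = j
    · subst hij; simp [unitExp]
    · simp [unitExp, hij]

theorem monomialOp_sub_mem {N : Submodule ℂ V} (hN : ∀ i v, u i v - v ∈ N)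
    (q : ι → Multiplicative ℤ) (v : V) : monomialOp u hu q v - v ∈ N := by
  revert v
  refine mem_of_unitExp_mem
    { carrier := {q | ∀ v, monomialOp u hu q v - v ∈ N}
      mul_mem' := fun {a b} ha hb v => ?_
      one_mem' := fun v => ?_
      inv_mem' := fun {a} ha v => ?_ } (fun i v => ?_) q
  · rw [map_mul, LinearEquiv.mul_apply]
    simpa using N.add_mem (ha (monomialOp u hu b v)) (hb v)
  · simp
  · have h := ha ((monomialOp u hu a).symm v)
    rw [LinearEquiv.apply_symm_apply] at h
    rw [map_inv, ← neg_mem_iff, neg_sub]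
    exact h
  · rw [monomialOp_unitExp]; exact hN i v

variable {D : ι → Module.End ℂ V} {κ : ι → ℤ}

theorem monomialOp_mem_jointEigenspace
    (hDu : ∀ j i v, D j (u i v) = u i (D j v) + (if i = j then (κ j : ℂ) else 0) • u i v)
    {χ : ι → ℂ} {v : V} (hv : v ∈ jointEigenspace D χ)
    (q : ι → Multiplicative ℤ) :
    monomialOp u hu q v ∈ jointEigenspace D fun j => χ j + κ j * ((q j).toAdd : ℂ) := by
  rw [mem_jointEigenspace] at hv ⊢
  intro j
  rw [monomialOp_shift hu (hDu j), hv j, map_smul, add_smul]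

/-- Invertible commuting operators `u i` that shift the eigenvalue of `D i` by `κ i ≠ 0` cannot
satisfy `∑ i, (u i - 1) V = V`: moving every joint eigenvector to a fundamental domain of
the group of shifts by the appropriate monomial in the `u i` is a non-zero operator, and it kills
all `u i v - v`. -/
theorem iSup_range_sub_one_ne_top (hu : ∀ i j, Commute (u i) (u j))
    (hDu : ∀ j i v, D j (u i v) = u i (D j v) + (if i = j then (κ j : ℂ) else 0) • u i v)
    (hκ : ∀ i, κ i ≠ 0) (hD : ∀ i j, Commute (D i) (D j))
    (htop : ⨆ χ, jointEigenspace D χ = ⊤) {c : ι → ℂ} {v₀ : V} (hv₀ : v₀ ∈ jointEigenspace D c)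
    (hne : v₀ ≠ 0) :
    ⨆ i, LinearMap.range ((u i : V →ₗ[ℂ] V) - 1) ≠ ⊤ := by
  classical
  have hint := DirectSum.isInternal_submodule_of_iSupIndep_of_iSup_eq_top
    (iSupIndep_jointEigenspace hD) htop
  let e := LinearEquiv.ofBijective (DirectSum.coeLinearMap (jointEigenspace D)) hint
  -- the exponent of the translate of the fundamental domain in which `χ` lies
  let q : (ι → ℂ) → ι → Multiplicative ℤ := fun χ i =>
    Multiplicative.ofAdd ⌊((χ i - c i) / κ i).re⌋
  let P : V →ₗ[ℂ] V := (DirectSum.toModule ℂ (ι → ℂ) V fun χ =>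
    ((monomialOp u hu (q χ)⁻¹ : V ≃ₗ[ℂ] V) : V →ₗ[ℂ] V) ∘ₗ (jointEigenspace D χ).subtype) ∘ₗ
      (e.symm : V →ₗ[ℂ] _)
  have hP : ∀ χ v, v ∈ jointEigenspace D χ → P v = monomialOp u hu (q χ)⁻¹ v := by
    intro χ v hv
    have : e.symm v = DirectSum.lof ℂ (ι → ℂ) (fun χ => jointEigenspace D χ) χ ⟨v, hv⟩ := by
      rw [LinearEquiv.symm_apply_eq]
      exact (DirectSum.coeLinearMap_lof (jointEigenspace D) χ ⟨v, hv⟩).symm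
    simp only [P, LinearMap.comp_apply, LinearEquiv.coe_coe, this, DirectSum.toModule_lof]
    rfl
  have hPu : ∀ i v, P (u i v) = P v := by
    intro i v
    refine Submodule.iSup_induction (jointEigenspace D) (motive := fun v => P (u i v) = P v)
      (htop ▸ Submodule.mem_top : v ∈ _) (fun χ v hv => ?_) (by simp)
      fun v w h₁ h₂ => by simp [h₁, h₂]
    have h := monomialOp_mem_jointEigenspace hu hDu hv (unitExp i)
    rw [monomialOp_unitExp] at h
    have hq : q (fun j => χ j + κ j * ((unitExp i j).toAdd : ℂ)) = unitExp i * q χ := by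
      ext j
      have hj : (κ j : ℂ) ≠ 0 := Int.cast_ne_zero.mpr (hκ j)
      have hdiv : (χ j + κ j * ((unitExp i j).toAdd : ℂ) - c j) / κ j =
          ((unitExp i j).toAdd : ℂ) + (χ j - c j) / κ j := by
        field_simp
        ring
      simp only [q, hdiv, Pi.mul_apply, toAdd_mul, toAdd_ofAdd, Complex.add_re,
        Complex.intCast_re, Int.floor_intCast_add]
    rw [hP _ _ h, hP _ _ hv, hq, mul_inv_rev, map_mul, LinearEquiv.mul_apply]
    rw [map_inv _ (unitExp i), monomialOp_unitExp]
    exact congrArg _ ((u i).symm_apply_apply v)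
  intro h
  have hker : ⨆ i, LinearMap.range ((u i : V →ₗ[ℂ] V) - 1) ≤ LinearMap.ker P := by
    refine iSup_le fun i => ?_
    rintro _ ⟨v, rfl⟩
    simp [hPu]
  rw [h] at hker
  have h0 : P v₀ = 0 := hker Submodule.mem_top
  have hq1 : q c = 1 := by
    ext i
    simp [q]
  rw [hP c v₀ hv₀, hq1] at h0
  exact hne (by simpa using h0)

end Linear

open LieAlgebra LieModule

/-! ### Weight modules -/

section Weights

variable {L : Type*} [LieRing L] [LieAlgebra ℂ L]
variable {V : Type*} [AddCommGroup V] [Module ℂ V] [LieRingModule L V] [LieModule ℂ L V]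

/-- On a weight module the elements of `T` act by commuting operators, even if `T` itself is not
commutative; so its weight spaces are simultaneous eigenspaces of commuting operators. -/
theorem iSupIndep_weightSpace {T : Submodule ℂ L}
    (h : ⨆ lam : T →ₗ[ℂ] ℂ, weightSpace V T lam = ⊤) : iSupIndep (weightSpace V T) := by
  let D : T → Module.End ℂ V := fun x => toEnd ℂ L V x
  have hD : ∀ x y, Commute (D x) (D y) := by
    intro x y
    refine LinearMap.ext fun v => ?_
    refine Submodule.iSup_induction (weightSpace V T)
      (motive := fun v => (D x * D y) v = (D y * D x) v)
      (h ▸ Submodule.mem_top : v ∈ _) (fun lam v hv => ?_) (by simp)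
      fun v w h₁ h₂ => by rw [map_add, map_add, h₁, h₂]
    simp only [D, Module.End.mul_apply, toEnd_apply_apply, lie_smul, hv x, hv y]
    exact smul_comm _ _ _
  have key : weightSpace V T = jointEigenspace D ∘ fun lam : T →ₗ[ℂ] ℂ => (lam : T → ℂ) := by
    ext lam v
    exact (mem_jointEigenspace (D := D)).symm
  rw [key]
  exact (iSupIndep_jointEigenspace hD).comp DFunLike.coe_injective

/-- The quotient of a Lie module by a maximal submodule is irreducible. -/
theorem isIrreducible_quotient_of_isCoatom {W : LieSubmodule ℂ L V} (hW : IsCoatom W) :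
    IsIrreducible ℂ L (V ⧸ W) := by
  have hsurj := LieSubmodule.Quotient.surjective_mk' W
  have hnt : Nontrivial (LieSubmodule ℂ L (V ⧸ W)) := by
    refine ⟨⊥, ⊤, fun hbt => hW.1 (eq_top_iff.mpr fun v _ => ?_)⟩
    rw [← LieSubmodule.Quotient.mk_eq_zero, ← LieSubmodule.mem_bot (R := ℂ) (L := L), hbt]
    exact LieSubmodule.mem_top _
  refine { eq_bot_or_eq_top := fun N => ?_ }
  have hle : W ≤ N.comap (LieSubmodule.Quotient.mk' W) := fun v hv => by
    rw [LieSubmodule.mem_comap, (LieSubmodule.Quotient.mk_eq_zero W).mpr hv]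
    exact N.zero_mem
  rcases hW.le_iff.mp hle with h | h
  · right
    refine eq_top_iff.mpr fun x _ => ?_
    obtain ⟨v, rfl⟩ := hsurj x
    exact LieSubmodule.mem_comap.mp (h ▸ LieSubmodule.mem_top v)
  · left
    refine eq_bot_iff.mpr fun x hx => ?_
    obtain ⟨v, rfl⟩ := hsurj x
    have : v ∈ W := h ▸ LieSubmodule.mem_comap.mpr hx
    rw [LieSubmodule.mem_bot]
    exact (LieSubmodule.Quotient.mk_eq_zero W).mpr this

end Weights

/-! ### Central operators and degrees on an irreducible module -/

section Module

variable {𝔤 : Type*} [LieRing 𝔤] [LieAlgebra ℂ 𝔤] {m : ℕ}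
variable {B : LinearMap.BilinForm ℂ 𝔤} {hB : B.lieInvariant 𝔤} {hS : B.IsSymm}

theorem JD.lie_d_d {V : Type*} [AddCommGroup V] [LieRingModule (JD m B hB hS) V]
    (i j : Fin (m + 1)) (v : V) :
    ⁅JD.d B hB hS i, ⁅JD.d B hB hS j, v⁆⁆ = ⁅JD.d B hB hS j, ⁅JD.d B hB hS i, v⁆⁆ := by
  have h : ⁅JD.d B hB hS i, JD.d B hB hS j⁆ = 0 := by
    rw [← LieHom.map_lie]
    exact map_zero _
  rw [leibniz_lie, h, zero_lie, zero_add]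

variable {V : Type*} [AddCommGroup V] [Module ℂ V] [LieRingModule (JD m B hB hS) V]
  [LieModule ℂ (JD m B hB hS) V]

theorem JD.eq_ofJ_add_sum (x : JD m B hB hS) :
    x = JD.ofJ B hB hS x.left + ∑ i, DegAlg.coord i x.right • JD.d B hB hS i := by
  have h : x.right = ∑ i, DegAlg.coord i x.right • DegAlg.d i := by
    refine (pi_eq_sum_univ' (R := ℂ) (x.right : Fin (m + 1) → ℂ)).trans ?_
    rfl
  have h2 : x = JD.ofJ B hB hS x.left + SemiDirectSum.inr _ x.right := by
    ext
    · simp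
    · simp
  nth_rw 1 [h2, h]
  simp only [map_sum, map_smul]

theorem JD.lie_eq (x : JD m B hB hS) (v : V) :
    ⁅x, v⁆ = ⁅JD.ofJ B hB hS x.left, v⁆ +
      ∑ i, DegAlg.coord i x.right • ⁅JD.d B hB hS i, v⁆ := by
  nth_rw 1 [JD.eq_ofJ_add_sum x]
  rw [add_lie, sum_lie]
  simp only [smul_lie]

/-- A subspace stable under `J` and under each `d_i`, as a submodule over `J ⊕ D`. -/
def lieSubmoduleOfStable (N : Submodule ℂ V)
    (hJ : ∀ (x : J m B hB hS) (v : V), v ∈ N → ⁅JD.ofJ B hB hS x, v⁆ ∈ N)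
    (hd : ∀ (i : Fin (m + 1)) (v : V), v ∈ N → ⁅JD.d B hB hS i, v⁆ ∈ N) :
    LieSubmodule ℂ (JD m B hB hS) V where
  __ := N
  lie_mem {x v} hv := by
    rw [JD.lie_eq]
    exact N.add_mem (hJ _ _ hv) (N.sum_mem fun i _ => N.smul_mem _ (hd i v hv))

theorem eq_top_of_stable [IsIrreducible ℂ (JD m B hB hS) V] (N : Submodule ℂ V)
    (hJ : ∀ (x : J m B hB hS) (v : V), v ∈ N → ⁅JD.ofJ B hB hS x, v⁆ ∈ N)
    (hd : ∀ (i : Fin (m + 1)) (v : V), v ∈ N → ⁅JD.d B hB hS i, v⁆ ∈ N) (hN : N ≠ ⊥) : N = ⊤ := by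
  rcases eq_bot_or_eq_top (lieSubmoduleOfStable N hJ hd) with h | h
  · exact absurd (congrArg LieSubmodule.toSubmodule h) hN
  · exact congrArg LieSubmodule.toSubmodule h

theorem IsCentralOperator.bijective [IsIrreducible ℂ (JD m B hB hS) V] {z : V →ₗ[ℂ] V}
    {k : Fin (m + 1) → ℤ} (hz : IsCentralOperator B hB hS z k) (h0 : z ≠ 0) :
    Function.Bijective z := by
  have hd : ∀ i v, ⁅JD.d B hB hS i, z v⁆ = z ⁅JD.d B hB hS i, v⁆ + (k i : ℂ) • z v :=
    fun i v => by rw [← hz.degree i v]; abel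
  constructor
  · rw [← LinearMap.ker_eq_bot]
    by_contra hne
    refine h0 (LinearMap.ker_eq_top.mp
      (eq_top_of_stable (B := B) (hB := hB) (hS := hS) (m := m) (LinearMap.ker z)
      (fun x v hv => ?_) (fun i v hv => ?_) hne))
    · rw [LinearMap.mem_ker] at hv ⊢
      rw [hz.comm, hv, lie_zero]
    · rw [LinearMap.mem_ker] at hv ⊢
      have := hd i v
      rw [hv, lie_zero, smul_zero, add_zero] at this
      exact this.symm
  · rw [← LinearMap.range_eq_top]
    refine eq_top_of_stable (B := B) (hB := hB) (hS := hS) (m := m) (LinearMap.range z) ?_ ?_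
      (by rwa [Ne, LinearMap.range_eq_bot])
    · rintro x _ ⟨v, rfl⟩
      exact ⟨_, hz.comm x v⟩
    · rintro i _ ⟨v, rfl⟩
      exact ⟨⁅JD.d B hB hS i, v⁆ + (k i : ℂ) • v, by rw [hd, map_add, map_smul]⟩

theorem JDlast.coord_castSucc (x : JDlast m B hB hS) (i : Fin m) :
    DegAlg.coord i.castSucc x.1.right = 0 := x.2 i

theorem JDlast.lie_eq (x : JDlast m B hB hS) (v : V) :
    ⁅x, v⁆ = ⁅JD.ofJ B hB hS x.1.left, v⁆ +
      DegAlg.coord (Fin.last m) x.1.right • ⁅JD.d B hB hS (Fin.last m), v⁆ := by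
  rw [LieSubalgebra.coe_bracket_of_module, JD.lie_eq, Fin.sum_univ_castSucc]
  simp only [JDlast.coord_castSucc, zero_smul, Finset.sum_const_zero, zero_add]

theorem IsCentralOperator.map_lie_last {z : V →ₗ[ℂ] V} {k : Fin (m + 1) → ℤ}
    (hz : IsCentralOperator B hB hS z k) (hk : k (Fin.last m) = 0) (x : JDlast m B hB hS) (v : V) :
    z ⁅x, v⁆ = ⁅x, z v⁆ := by
  have hd := hz.degree (Fin.last m) v
  rw [hk, Int.cast_zero, zero_smul, sub_eq_zero] at hd
  rw [JDlast.lie_eq, JDlast.lie_eq, map_add, map_smul, hz.comm, hd]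

variable (B hB hS V) in
/-- The action of `d_1, …, d_m` on `V`. -/
def degEnd (i : Fin m) : Module.End ℂ V := toEnd ℂ (JD m B hB hS) V (JD.d B hB hS i.castSucc)

theorem degEnd_apply (i : Fin m) (v : V) :
    degEnd B hB hS V i v = ⁅JD.d B hB hS i.castSucc, v⁆ := rfl

theorem degEnd_commute (i j : Fin m) : Commute (degEnd B hB hS V i) (degEnd B hB hS V j) :=
  LinearMap.ext fun v => JD.lie_d_d _ _ v

theorem JD.lie_d_lie_ofJ (i : Fin m) (r : Fin m → ℤ) (c : ℂ) (x : Aff B hB hS) (v : V) :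
    ⁅JD.d B hB hS i.castSucc, ⁅JD.ofJ B hB hS (AddMonoidAlgebra.single r c ⊗ₜ[ℂ] x), v⁆⁆ =
      ⁅JD.ofJ B hB hS (AddMonoidAlgebra.single r c ⊗ₜ[ℂ] x), ⁅JD.d B hB hS i.castSucc, v⁆⁆ +
        (r i : ℂ) • ⁅JD.ofJ B hB hS (AddMonoidAlgebra.single r c ⊗ₜ[ℂ] x), v⁆ := by
  have h1 : (DegAlg.d i.castSucc : DegAlg m).pairing r = (r i : ℂ) := by
    simp [DegAlg.pairing, DegAlg.coord_d]
  have h2 : DegAlg.coord (Fin.last m) (DegAlg.d i.castSucc : DegAlg m) = 0 := by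
    rw [DegAlg.coord_d, if_neg (Fin.castSucc_lt_last i).ne']
  rw [leibniz_lie, JD.lie_d_ofJ, degJ_tmul, h1, h2, zero_smul, add_zero, TensorProduct.tmul_smul,
    map_smul, smul_lie, add_comm]

/-- The eigenvalues of `d_1, …, d_m` on an irreducible module lie in one coset of `ℤ^m`. -/
theorem iSup_jointEigenspace_coset [IsIrreducible ℂ (JD m B hB hS) V] {c : Fin m → ℂ} {v₀ : V}
    (hv₀ : v₀ ∈ jointEigenspace (degEnd B hB hS V) c) (hne : v₀ ≠ 0) :
    ⨆ a : Fin m → ℤ, jointEigenspace (degEnd B hB hS V) (fun i => c i + a i) = ⊤ := by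
  set E := fun a : Fin m → ℤ => jointEigenspace (degEnd B hB hS V) (fun i => c i + a i) with hE
  refine eq_top_of_stable (B := B) (hB := hB) (hS := hS) (m := m) _ (fun x v hv => ?_)
      (fun i v hv => ?_)
    fun hbot => hne ?_
  · refine Submodule.iSup_induction E (motive := fun v => ⁅JD.ofJ B hB hS x, v⁆ ∈ ⨆ a, E a) hv
      (fun a v hv => ?_) (by simp) fun v w h₁ h₂ => by
        rw [lie_add]; exact Submodule.add_mem _ h₁ h₂
    induction x using J_induction with
    | h0 => rw [map_zero, zero_lie]; exact Submodule.zero_mem _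
    | h2 f g hf hg => rw [map_add, add_lie]; exact Submodule.add_mem _ hf hg
    | h1 r c x =>
      refine Submodule.mem_iSup_of_mem (a + r) (mem_jointEigenspace.mpr fun i => ?_)
      have h := mem_jointEigenspace.mp hv i
      rw [degEnd_apply] at h ⊢
      rw [JD.lie_d_lie_ofJ, h, lie_smul, ← add_smul, Pi.add_apply, Int.cast_add, add_assoc]
  · refine Submodule.iSup_induction E (motive := fun v => ⁅JD.d B hB hS i, v⁆ ∈ ⨆ a, E a) hv
      (fun a v hv => ?_) (by simp) fun v w h₁ h₂ => by
        rw [lie_add]; exact Submodule.add_mem _ h₁ h₂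
    refine Submodule.mem_iSup_of_mem a (mem_jointEigenspace.mpr fun j => ?_)
    rw [degEnd_apply, JD.lie_d_d, ← degEnd_apply, mem_jointEigenspace.mp hv j, lie_smul]
  · have : v₀ ∈ ⨆ a, E a := Submodule.mem_iSup_of_mem 0 (by simpa [hE] using hv₀)
    rwa [hbot, Submodule.mem_bot] at this

/-- A simultaneous eigenvector of the degree operators generates an irreducible
`J ⊕ D`-module already over `J ⊕ ℂ d_{m+1}`: the vectors of the generated submodule which all
`d_i` map into it form a `J ⊕ D`-submodule. -/
theorem lieSpan_eq_top [IsIrreducible ℂ (JD m B hB hS) V] {c : Fin m → ℂ} {v₀ : V}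
    (hv₀ : v₀ ∈ jointEigenspace (degEnd B hB hS V) c) (hne : v₀ ≠ 0) :
    LieSubmodule.lieSpan ℂ (JDlast m B hB hS) {v₀} = ⊤ := by
  set N := LieSubmodule.lieSpan ℂ (JDlast m B hB hS) {v₀}
  have hv₀N : v₀ ∈ N := LieSubmodule.subset_lieSpan rfl
  have memJ : ∀ x : J m B hB hS, JD.ofJ B hB hS x ∈ JDlast m B hB hS := fun x i => map_zero _
  have memd : JD.d B hB hS (Fin.last m) ∈ JDlast m B hB hS := fun i => by
    change DegAlg.coord i.castSucc (DegAlg.d (Fin.last m)) = 0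
    rw [DegAlg.coord_d, if_neg (Fin.castSucc_lt_last i).ne]
  have hJ : ∀ (x : J m B hB hS) v, v ∈ N → ⁅JD.ofJ B hB hS x, v⁆ ∈ N :=
    fun x v hv => N.lie_mem (x := (⟨_, memJ x⟩ : JDlast m B hB hS)) hv
  have hlast : ∀ v, v ∈ N → ⁅JD.d B hB hS (Fin.last m), v⁆ ∈ N :=
    fun v hv => N.lie_mem (x := (⟨_, memd⟩ : JDlast m B hB hS)) hv
  have hd : ∀ i : Fin m, ∀ v ∈ N, ⁅JD.d B hB hS i.castSucc, v⁆ ∈ N := by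
    intro i
    let N' : LieSubmodule ℂ (JDlast m B hB hS) V :=
      { toSubmodule := N.toSubmodule ⊓ N.toSubmodule.comap (degEnd B hB hS V i)
        lie_mem := by
          rintro x v ⟨hv, hdv⟩
          have hdv' : ⁅JD.d B hB hS i.castSucc, v⁆ ∈ N := hdv
          refine ⟨N.lie_mem hv, ?_⟩
          change ⁅JD.d B hB hS i.castSucc, ⁅x, v⁆⁆ ∈ N
          rw [JDlast.lie_eq, lie_add, lie_smul, JD.lie_d_d, leibniz_lie, JD.lie_d_ofJ]
          exact N.add_mem (N.add_mem (hJ _ _ hv) (hJ _ _ hdv')) (N.smul_mem _ (hlast _ hdv')) }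
    have hle : N ≤ N' := by
      refine LieSubmodule.lieSpan_le.mpr ?_
      rintro v rfl
      refine ⟨hv₀N, ?_⟩
      change degEnd B hB hS V i v ∈ N
      rw [mem_jointEigenspace.mp hv₀ i]
      exact N.smul_mem _ hv₀N
    exact fun v hv => (hle hv).2
  have htop := eq_top_of_stable (B := B) (hB := hB) (hS := hS) N.toSubmodule hJ
    (fun i => Fin.lastCases hlast hd i) fun hbot => hne (by
      have : v₀ ∈ N.toSubmodule := hv₀N
      rwa [hbot, Submodule.mem_bot] at this)
  exact (LieSubmodule.toSubmodule_eq_top N).mp htop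

end Module

/-! ### Restriction of weights to `h ⊕ ℂ K ⊕ ℂ d_{m+1}` -/

section Restriction

variable {𝔤 : Type*} [LieRing 𝔤] [LieAlgebra ℂ 𝔤] {m : ℕ}
variable {B : LinearMap.BilinForm ℂ 𝔤} {hB : B.lieInvariant 𝔤} {hS : B.IsSymm}
variable {V : Type*} [AddCommGroup V] [Module ℂ V] [LieRingModule (JD m B hB hS) V]
  [LieModule ℂ (JD m B hB hS) V] {H : LieSubalgebra ℂ 𝔤}

theorem cartan_mono {S T : Set (Fin (m + 1))} (h : S ⊆ T) :
    cartan B hB hS H S ≤ cartan B hB hS H T :=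
  Submodule.span_mono (Set.union_subset_union_right _ (Set.image_mono h))

theorem JD.d_mem_cartan {S : Set (Fin (m + 1))} {i : Fin (m + 1)} (h : i ∈ S) :
    JD.d B hB hS i ∈ cartan B hB hS H S :=
  Submodule.subset_span (Or.inr ⟨i, h, rfl⟩)

theorem weightSpace_cartan_le_jointEigenspace
    (lam : cartan (m := m) B hB hS H Set.univ →ₗ[ℂ] ℂ) :
    weightSpace V (cartan B hB hS H Set.univ) lam ≤
      jointEigenspace (degEnd B hB hS V)
        (fun i => lam ⟨JD.d B hB hS i.castSucc, JD.d_mem_cartan (Set.mem_univ _)⟩) :=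
  fun _ hv => mem_jointEigenspace.mpr fun _ => hv ⟨_, _⟩

theorem weightSpace_cartan_le_weightSpace_cartanLast
    (lam : cartan (m := m) B hB hS H Set.univ →ₗ[ℂ] ℂ) :
    ∃ mu : cartanLast (m := m) B hB hS H →ₗ[ℂ] ℂ,
      weightSpace V (cartan B hB hS H Set.univ) lam ≤
        weightSpace V (cartanLast (m := m) B hB hS H) mu := by
  let f : cartanLast (m := m) B hB hS H →ₗ[ℂ] cartan (m := m) B hB hS H Set.univ :=
    LinearMap.codRestrict _
      ((JDlast m B hB hS).toSubmodule.subtype ∘ₗ (cartanLast (m := m) B hB hS H).subtype)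
      fun x => cartan_mono (Set.subset_univ _) x.2
  exact ⟨lam ∘ₗ f, fun v hv x => hv (f x)⟩

theorem mem_weightSpace_cartan {v : V} {mu : cartanLast (m := m) B hB hS H →ₗ[ℂ] ℂ}
    {χ : Fin m → ℂ} {lam : JD m B hB hS →ₗ[ℂ] ℂ}
    (hlast : ∀ x : cartanLast (m := m) B hB hS H, lam x = mu x)
    (hd : ∀ i : Fin m, lam (JD.d B hB hS i.castSucc) = χ i)
    (hv : v ∈ weightSpace V (cartanLast (m := m) B hB hS H) mu)
    (hχ : v ∈ jointEigenspace (degEnd B hB hS V) χ) :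
    v ∈ weightSpace V (cartan B hB hS H Set.univ) (lam ∘ₗ Submodule.subtype _) := by
  have hL : ∀ x (hx : x ∈ cartan (m := m) B hB hS H {Fin.last m}), ⁅x, v⁆ = lam x • v := by
    intro x hx
    have h := hv ⟨⟨x, cartan_last_le B hB hS H hx⟩, hx⟩
    rw [← hlast] at h
    exact h
  rintro ⟨x, hx⟩
  change ⁅x, v⁆ = lam x • v
  induction hx using Submodule.span_induction with
  | zero => simp only [zero_lie, map_zero, zero_smul]
  | add x y _ _ h₁ h₂ => rw [add_lie, h₁, h₂, map_add, add_smul]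
  | smul c x _ h => rw [smul_lie, h, map_smul, smul_eq_mul, mul_smul]
  | mem x hx =>
    rcases hx with hx | ⟨i, -, rfl⟩
    · exact hL x (Submodule.subset_span (Or.inl hx))
    · induction i using Fin.lastCases with
      | last => exact hL _ (JD.d_mem_cartan rfl)
      | cast i => rw [hd]; exact mem_jointEigenspace.mp hχ i

/-- A weight of `h ⊕ ℂ K ⊕ ℂ d_{m+1}` and eigenvalues of `d_1, …, d_m` together make up a weight
of `h ⊕ ℂ K ⊕ D`. -/
theorem exists_inf_le_weightSpace_cartan (mu : cartanLast (m := m) B hB hS H →ₗ[ℂ] ℂ)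
    (χ : Fin m → ℂ) :
    ∃ lam : cartan (m := m) B hB hS H Set.univ →ₗ[ℂ] ℂ,
      weightSpace V (cartanLast (m := m) B hB hS H) mu ⊓ jointEigenspace (degEnd B hB hS V) χ ≤
        weightSpace V (cartan B hB hS H Set.univ) lam := by
  obtain ⟨g, hg⟩ := mu.exists_extend
  obtain ⟨g', hg'⟩ := LinearMap.exists_extend (p := (JDlast m B hB hS).toSubmodule) g
  have hgmu : ∀ x : cartanLast (m := m) B hB hS H, g' x = mu x := fun x => by
    rw [← hg, ← hg']; rfl
  let r : Fin m → (JD m B hB hS →ₗ[ℂ] ℂ) := fun i =>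
    DegAlg.coord i.castSucc ∘ₗ (SemiDirectSum.projr (degAction (m := m) B hB hS)).toLinearMap
  -- extend `mu` to a functional `g'` on `J ⊕ D`, then correct its values on `d_1, …, d_m`
  let lam : JD m B hB hS →ₗ[ℂ] ℂ := g' + ∑ i, (χ i - g' (JD.d B hB hS i.castSucc)) • r i
  refine ⟨lam ∘ₗ Submodule.subtype _, fun v hv =>
    mem_weightSpace_cartan (fun x => ?_) (fun i => ?_) hv.1 hv.2⟩
  · have hr : ∀ i, r i x = 0 := fun i => JDlast.coord_castSucc x.1 i
    simp only [lam, LinearMap.add_apply, LinearMap.sum_apply, LinearMap.smul_apply, hr, smul_zero,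
      Finset.sum_const_zero, add_zero, hgmu]
  · have hr : ∀ j, r j (JD.d B hB hS i.castSucc) = if j = i then 1 else 0 := fun j => by
      change DegAlg.coord j.castSucc (DegAlg.d i.castSucc) = _
      rw [DegAlg.coord_d]
      simp only [Fin.castSucc_inj]
    simp only [lam, LinearMap.add_apply, LinearMap.sum_apply, LinearMap.smul_apply, hr]
    simp

/-! ### The quotient -/

/-- The quotient of `V` by a submodule containing all `u i v - v` is a weight module with
finite-dimensional weight spaces: modulo these vectors every weight vector of `V` is congruent to
one whose `d_i`-eigenvalue is `c i + r` with `0 ≤ r < |k i|`, which leaves finitely many weights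
over each weight of `h ⊕ ℂ K ⊕ ℂ d_{m+1}`. -/
theorem isFiniteWeightModule_quotient [IsIrreducible ℂ (JD m B hB hS) V]
    (hfin : IsFiniteWeightModule V (cartan (m := m) B hB hS H Set.univ))
    {c : Fin m → ℂ} {v₀ : V} (hv₀ : v₀ ∈ jointEigenspace (degEnd B hB hS V) c) (hne : v₀ ≠ 0)
    {u : Fin m → V ≃ₗ[ℂ] V} (hu : ∀ i j, Commute (u i) (u j)) {k : Fin m → ℤ} (hk : ∀ i, k i ≠ 0)
    (hDu : ∀ j i v, degEnd B hB hS V j (u i v) =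
      u i (degEnd B hB hS V j v) + (if i = j then (k j : ℂ) else 0) • u i v)
    (hlie : ∀ i (x : JDlast m B hB hS) v, ⁅x, u i v⁆ = u i ⁅x, v⁆)
    {W : LieSubmodule ℂ (JDlast m B hB hS) V} (hW : ∀ i v, u i v - v ∈ W) :
    IsFiniteWeightModule (V ⧸ W) (cartanLast (m := m) B hB hS H) := by
  classical
  set E := jointEigenspace (degEnd (m := m) B hB hS V)
  let π : V →ₗ[ℂ] V ⧸ W := W.toSubmodule.mkQ
  have hπ : ∀ (x : JDlast m B hB hS) v, ⁅x, π v⁆ = π ⁅x, v⁆ := fun _ _ => rfl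
  let box : Finset (Fin m → ℤ) := Fintype.piFinset fun i => Finset.Ico 0 |k i|
  let F : (cartanLast (m := m) B hB hS H →ₗ[ℂ] ℂ) → Submodule ℂ V := fun mu =>
    ⨆ r : box, weightSpace V (cartanLast (m := m) B hB hS H) mu ⊓
      E fun i => c i + ((r : Fin m → ℤ) i : ℂ)
  have hFfin : ∀ mu, FiniteDimensional ℂ (F mu) := fun mu => by
    have : ∀ r : box, FiniteDimensional ℂ ↥(weightSpace V (cartanLast (m := m) B hB hS H) mu ⊓
        E fun i => c i + ((r : Fin m → ℤ) i : ℂ)) := fun r => by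
      obtain ⟨lam, hlam⟩ := exists_inf_le_weightSpace_cartan (V := V) mu
        fun i => c i + ((r : Fin m → ℤ) i : ℂ)
      have := hfin.2 lam
      exact Submodule.finiteDimensional_of_le hlam
    exact Submodule.finiteDimensional_iSup _
  have hFle : ∀ mu, (F mu).map π ≤ weightSpace (V ⧸ W) (cartanLast (m := m) B hB hS H) mu := by
    rintro mu _ ⟨v, hv, rfl⟩ x
    have hle : F mu ≤ weightSpace V (cartanLast (m := m) B hB hS H) mu :=
      iSup_le fun _ => inf_le_left
    have hv' := hle hv
    rw [hπ, hv' x, map_smul]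
  have hE : ∀ χ : Fin m → ℂ, E χ ≠ ⊥ → ∃ a : Fin m → ℤ, χ = fun i => c i + a i := by
    intro χ hχ
    by_contra hcon
    -- the eigenspaces over `c + ℤ^m` already span, so by independence the others vanish
    let G : (Fin m → ℂ) → Submodule ℂ V := fun χ =>
      if ∃ a : Fin m → ℤ, χ = fun i => c i + a i then E χ else ⊥
    have hGE : ∀ χ, G χ ≤ E χ := fun χ => by
      simp only [G]; split_ifs
      · exact le_rfl
      · exact bot_le
    have hG : ⨆ χ, G χ = ⊤ := by
      rw [eq_top_iff, ← iSup_jointEigenspace_coset hv₀ hne]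
      refine iSup_le fun a => le_iSup_of_le (fun i => c i + (a i : ℂ)) ?_
      simp only [G]
      rw [if_pos ⟨a, rfl⟩]
    have h := (iSupIndep_jointEigenspace degEnd_commute).eq_of_le_of_iSup_eq_top hGE hG χ
    refine hχ ?_
    change G χ = E χ at h
    rw [← h]
    exact if_neg hcon
  have hFtop : ⨆ mu, (F mu).map π = ⊤ := by
    have hπtop : (⊤ : Submodule ℂ V).map π = ⊤ := by
      rw [Submodule.map_top, Submodule.range_mkQ]
    rw [eq_top_iff, ← hπtop, ← hfin.1, Submodule.map_iSup]
    refine iSup_le fun lam => ?_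
    obtain ⟨mu, hmu⟩ := weightSpace_cartan_le_weightSpace_cartanLast (V := V) lam
    refine le_iSup_of_le mu ?_
    rintro _ ⟨v, hv, rfl⟩
    rcases eq_or_ne v 0 with rfl | hv0
    · rw [map_zero]; exact Submodule.zero_mem _
    have hvE := weightSpace_cartan_le_jointEigenspace lam hv
    obtain ⟨a, ha⟩ := hE _ fun hbot => hv0 ((Submodule.mem_bot ℂ).mp (hbot ▸ hvE))
    rw [ha] at hvE
    -- the monomial that translates the eigenvalues into the box
    let q : Fin m → Multiplicative ℤ := fun i => Multiplicative.ofAdd (-(a i / k i))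
    have hmem := monomialOp_mem_jointEigenspace hu hDu hvE q
    have hW' := monomialOp_sub_mem (N := W.toSubmodule) hu hW q v
    refine ⟨monomialOp u hu q v, ?_, ?_⟩
    · refine Submodule.mem_iSup_of_mem
        (⟨fun i => a i % k i, Fintype.mem_piFinset.mpr fun i => Finset.mem_Ico.mpr
          ⟨Int.emod_nonneg _ (hk i), Int.emod_lt_abs _ (hk i)⟩⟩ : box) ⟨fun x => ?_, ?_⟩
      · have := monomialOp_commute hu (T := toEnd ℂ (JDlast m B hB hS) V x)
          (fun i v => hlie i x v) q v
        rw [toEnd_apply_apply, toEnd_apply_apply, hmu hv x, map_smul] at this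
        exact this
      · have hr : (fun i => c i + ((a i % k i : ℤ) : ℂ)) =
            fun i => c i + (a i : ℂ) + k i * ((q i).toAdd : ℂ) := by
          funext i
          simp only [q, toAdd_ofAdd, Int.emod_def]
          push_cast
          ring
        change _ ∈ E fun i => c i + ((a i % k i : ℤ) : ℂ)
        rw [hr]
        exact hmem
    · rw [← sub_eq_zero, ← map_sub]
      exact (Submodule.Quotient.mk_eq_zero _).mpr hW'
  have htop : ⨆ mu, weightSpace (V ⧸ W) (cartanLast (m := m) B hB hS H) mu = ⊤ :=
    eq_top_iff.mpr (hFtop ▸ iSup_mono hFle)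
  refine ⟨htop, fun mu => ?_⟩
  rw [← (iSupIndep_weightSpace htop).eq_of_le_of_iSup_eq_top hFle hFtop mu]
  infer_instance

end Restriction

end Toroidal
end

open Toroidal in
theorem mainTheorem4
    {𝔤 : Type*} [LieRing 𝔤] [LieAlgebra ℂ 𝔤] [FiniteDimensional ℂ 𝔤] [LieAlgebra.IsSimple ℂ 𝔤]
    (B : LinearMap.BilinForm ℂ 𝔤) (hB : B.lieInvariant 𝔤) (hS : B.IsSymm) (hN : B.Nondegenerate)
    (H : LieSubalgebra ℂ 𝔤) [H.IsCartanSubalgebra]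
    (m : ℕ) (hm : 1 ≤ m)
    {V : Type*} [AddCommGroup V] [Module ℂ V] [LieRingModule (Toroidal.JD m B hB hS) V]
    [LieModule ℂ (Toroidal.JD m B hB hS) V]
    (hirr : LieModule.IsIrreducible ℂ (Toroidal.JD m B hB hS) V)
    (hfin : Toroidal.IsFiniteWeightModule V (Toroidal.cartan (m := m) B hB hS H Set.univ))
    (k : Fin m → ℤ) (hk : ∀ i, k i ≠ 0)
    (z : Fin m → V →ₗ[ℂ] V) (hz0 : ∀ i, z i ≠ 0)
    (hz : ∀ i, Toroidal.IsCentralOperator B hB hS (z i) (Pi.single i.castSucc (k i)))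
    (hcomm : ∀ i j, Commute (z i) (z j)) :
    ∃ W : LieSubmodule ℂ (Toroidal.JDlast m B hB hS) V,
      IsCoatom W ∧
      LieModule.IsIrreducible ℂ (Toroidal.JDlast m B hB hS) (V ⧸ W) ∧
      Toroidal.IsFiniteWeightModule (V ⧸ W) (Toroidal.cartanLast (m := m) B hB hS H) ∧
      ∀ (i : Fin m) (v : V), z i v - v ∈ W := by
  let u : Fin m → V ≃ₗ[ℂ] V := fun i => LinearEquiv.ofBijective (z i) ((hz i).bijective (hz0 i))
  have huz : ∀ i v, u i v = z i v := fun i v => rfl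
  have hu : ∀ i j, Commute (u i) (u j) := fun i j =>
    LinearEquiv.ext fun v => LinearMap.congr_fun (hcomm i j) v
  have hDu : ∀ j i v, degEnd B hB hS V j (u i v) =
      u i (degEnd B hB hS V j v) + (if i = j then (k j : ℂ) else 0) • u i v := by
    intro j i v
    have h := (hz i).degree j.castSucc v
    have hs : ((Pi.single i.castSucc (k i) : Fin (m + 1) → ℤ) j.castSucc : ℂ) =
        if i = j then (k j : ℂ) else 0 := by
      by_cases hij : i = j
      · subst hij; simp
      · simp [hij, Ne.symm hij]
    rw [hs] at h
    rw [degEnd_apply, degEnd_apply, huz, huz, ← h]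
    abel
  have hlie : ∀ i (x : JDlast m B hB hS) v, z i ⁅x, v⁆ = ⁅x, z i v⁆ := fun i =>
    (hz i).map_lie_last (Pi.single_eq_of_ne (Fin.castSucc_lt_last i).ne' _)
  -- a weight vector to start from
  obtain ⟨lam, hlam⟩ : ∃ lam, weightSpace V (cartan (m := m) B hB hS H Set.univ) lam ≠ ⊥ := by
    by_contra! hbot
    have h := hfin.1
    simp only [hbot, iSup_bot] at h
    exact bot_ne_top (α := LieSubmodule ℂ (JD m B hB hS) V)
      ((LieSubmodule.toSubmodule_inj _ _).mp h)
  obtain ⟨v₀, hv, hv₀⟩ := (Submodule.ne_bot_iff _).mp hlam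
  have hvE := weightSpace_cartan_le_jointEigenspace lam hv
  have htopE : ⨆ χ, jointEigenspace (degEnd (m := m) B hB hS V) χ = ⊤ := by
    rw [eq_top_iff, ← hfin.1]
    exact iSup_le fun lam => le_iSup_of_le _ (weightSpace_cartan_le_jointEigenspace lam)
  let f : Fin m → V →ₗ⁅ℂ, JDlast m B hB hS⁆ V := fun i =>
    { toLinearMap := z i - 1
      map_lie' := fun {x v} => by
        change z i ⁅x, v⁆ - ⁅x, v⁆ = ⁅x, z i v - v⁆
        rw [hlie, lie_sub] }
  let W₀ : LieSubmodule ℂ (JDlast m B hB hS) V := ⨆ i, (f i).range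
  have hW₀ : W₀ ≠ ⊤ := by
    intro h
    refine iSup_range_sub_one_ne_top hu hDu hk degEnd_commute htopE hvE hv₀ ?_
    have h' := congrArg LieSubmodule.toSubmodule h
    rw [LieSubmodule.iSup_toSubmodule] at h'
    exact h'
  have hcoat : IsCoatomic (LieSubmodule ℂ (JDlast m B hB hS) V) :=
    CompleteLattice.coatomic_of_top_compact
      (lieSpan_eq_top hvE hv₀ ▸ LieSubmodule.isCompactElement_lieSpan_singleton _ _ v₀)
  obtain ⟨W, hW, hle⟩ := (eq_top_or_exists_le_coatom W₀).resolve_left hW₀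
  have hzW : ∀ i v, z i v - v ∈ W := fun i v =>
    hle (LieSubmodule.mem_iSup_of_mem i ⟨v, rfl⟩)
  exact ⟨W, hW, isIrreducible_quotient_of_isCoatom hW,
    isFiniteWeightModule_quotient hfin hvE hv₀ hu hk hDu (fun i x v => (hlie i x v).symm) hzW,
    hzW⟩
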